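/- Let $H$ be a real separable Hilbert space, let $V_0:H\to H$ be a bounded, self-adjoint, positive operator with bounded inverse, and let $f^*\in H$. For a positive operator $A$ write $\|x\|_A=\sqrt{\langle x,Ax\rangle}$. On a probability space with a filtration $(\mathcal G_t)_{t\ge 1}$ (where $\mathcal G_t$ is the information available just before the $t$-th observation: all earlier rounds and the current action), let $v_t\in H$ and $\rho_t>0$ be $\mathcal G_t$-measurable, let $\epsilon_t\in\mathbb R$ be $\mathcal G_{t+1}$-measurable and conditionally $\rho_t$-subgaussian, $$\mathbb E\big[e^{\lambda\epsilon_t}\,\big|\,\mathcal G_t\big]\le \exp\!\big(\lambda^2\rho_t^2/2\big)\quad\text{a.s., for all }\lambda\in\mathbb R,\ t\ge 1,$$ and let $y_t=\langle v_t,f^*\rangle+\epsilon_t$. For $T\ge 1$ let $M_T:H\to\mathbb R^T$, $(M_Tv)_t=\langle v_t,v\rangle$, with adjoint $M_T^*$, let $\Sigma_T=\operatorname{diag}(\rho_1^2,\dots,\rho_T^2)$, $y_{1:T}=(y_1,\dots,y_T)$, $V_T=M_T^*\Sigma_T^{-1}M_T+V_0$, and let $$\hat\mu_T=\operatorname*{arg\,min}_{f\in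 H}\ \|M_Tf-y_{1:T}\|_{\Sigma_T^{-1}}^2+\|f\|_{V_0}^2 .$$ Then for every $\delta\in(0,1)$, with probability at least $1-\delta$, for all $T\ge 1$ and all $v\in H$ simultaneously, $$|\langle v,\hat\mu_T\rangle-\langle v,f^*\rangle|\le\left(\sqrt{2\log\!\Big(\tfrac1\delta\,\det(\Sigma_T+M_TV_0^{-1}M_T^*)^{1/2}\det(\Sigma_T)^{-1/2}\Big)}+\|f^*\|_{V_0}\right)\|v\|_{V_T^{-1}} .$$ -/

import Mathlib

open MeasureTheory ProbabilityTheory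
open scoped RealInnerProductSpace

namespace HetLS

noncomputable section

/-- The norm `‖x‖_A = √⟨x, A x⟩` induced by a positive operator `A`. -/
def weightedNorm {E : Type*} [NormedAddCommGroup E] [InnerProductSpace ℝ E]
    (A : E →L[ℝ] E) (x : E) : ℝ :=
  Real.sqrt ⟪x, A x⟫

/-- The noise matrix `Σ = diag(r₁², …, r_T²)`, as an operator on Euclidean `ℝ^T`. -/
def noiseOp {T : ℕ} (r : Fin T → ℝ) :
    EuclideanSpace ℝ (Fin T) →L[ℝ] EuclideanSpace ℝ (Fin T) :=
  Matrix.toEuclideanCLM (n := Fin T) (𝕜 := ℝ) (Matrix.diagonal fun t => r t ^ 2)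

variable {H : Type*} [NormedAddCommGroup H] [InnerProductSpace ℝ H]

/-- The design operator `M : H → ℝ^T`, `(M x)_t = ⟨u_t, x⟩`. -/
def designOp {T : ℕ} (u : Fin T → H) : H →L[ℝ] EuclideanSpace ℝ (Fin T) :=
  (EuclideanSpace.equiv (Fin T) ℝ).symm.toContinuousLinearMap ∘L
    ContinuousLinearMap.pi fun t => innerSL ℝ (u t)

/-- The least squares objective `‖M f - z‖²_{Σ⁻¹} + ‖f‖²_{V₀}`. -/
def objective {T : ℕ} (V₀ : H →L[ℝ] H) (u : Fin T → H) (r : Fin T → ℝ)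
    (z : EuclideanSpace ℝ (Fin T)) (f : H) : ℝ :=
  weightedNorm (Ring.inverse (noiseOp r)) (designOp u f - z) ^ 2 + weightedNorm V₀ f ^ 2

/-- The regularized weighted least squares estimator, i.e. the minimizer of the objective over `H`.
When `V₀` is positive and invertible and all `r t` are positive, the minimizer
exists and is unique: see `estimator_spec`. -/
def estimator {T : ℕ} (V₀ : H →L[ℝ] H) (u : Fin T → H) (r : Fin T → ℝ)
    (z : EuclideanSpace ℝ (Fin T)) : H :=
  Classical.epsilon fun f => IsMinOn (objective V₀ u r z) Set.univ f

theorem noiseOp_eq_unit {T : ℕ} {r : Fin T → ℝ} (hr : ∀ t, 0 < r t) :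
    IsUnit (noiseOp r) ∧ Ring.inverse (noiseOp r) =
      Matrix.toEuclideanCLM (n := Fin T) (𝕜 := ℝ) (Matrix.diagonal fun t => (r t ^ 2)⁻¹) := by
  have hne : ∀ t, r t ^ 2 ≠ 0 := fun t => (pow_pos (hr t) 2).ne'
  have h1 : noiseOp r * Matrix.toEuclideanCLM (n := Fin T) (𝕜 := ℝ)
      (Matrix.diagonal fun t => (r t ^ 2)⁻¹) = 1 := by
    rw [noiseOp, ← map_mul, Matrix.diagonal_mul_diagonal]
    simp [hne]
  have h2 : Matrix.toEuclideanCLM (n := Fin T) (𝕜 := ℝ)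
      (Matrix.diagonal fun t => (r t ^ 2)⁻¹) * noiseOp r = 1 := by
    rw [noiseOp, ← map_mul, Matrix.diagonal_mul_diagonal]
    simp [hne]
  exact ⟨⟨⟨_, _, h1, h2⟩, rfl⟩, Ring.inverse_unit ⟨_, _, h1, h2⟩⟩

theorem ringInverse_noiseOp_apply {T : ℕ} {r : Fin T → ℝ} (hr : ∀ t, 0 < r t)
    (z : EuclideanSpace ℝ (Fin T)) (t : Fin T) :
    Ring.inverse (noiseOp r) z t = (r t ^ 2)⁻¹ * z t := by
  rw [(noiseOp_eq_unit hr).2, Matrix.ofLp_toEuclideanCLM, Matrix.mulVec_diagonal]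

theorem isPositive_ringInverse_noiseOp {T : ℕ} {r : Fin T → ℝ} (hr : ∀ t, 0 < r t) :
    (Ring.inverse (noiseOp r)).IsPositive := by
  refine (ContinuousLinearMap.isPositive_iff _).2 ⟨fun a b => ?_, fun a => ?_⟩
  · simp only [ContinuousLinearMap.coe_coe, PiLp.inner_apply, ringInverse_noiseOp_apply hr]
    refine Finset.sum_congr rfl fun t _ => ?_
    simp
    ring
  · simp only [PiLp.inner_apply, ringInverse_noiseOp_apply hr]
    refine Finset.sum_nonneg fun t _ => ?_
    have : 0 ≤ (r t ^ 2)⁻¹ * (a t * a t) := mul_nonneg (by positivity) (mul_self_nonneg _)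
    simp only [RCLike.inner_apply, conj_trivial]
    linarith

theorem designOp_apply {T : ℕ} (u : Fin T → H) (x : H) (t : Fin T) :
    designOp u x t = ⟪u t, x⟫ := by
  simp [designOp]

theorem coercive_of_isPositive_of_isUnit {V : H →L[ℝ] H} (hV : V.IsPositive) (hu : IsUnit V) :
    ∃ c : ℝ, 0 < c ∧ ∀ x, c * ‖x‖ ^ 2 ≤ ⟪x, V x⟫ := by
  obtain ⟨U, rfl⟩ := hu
  set W : H →L[ℝ] H := ((U⁻¹ : (H →L[ℝ] H)ˣ) : H →L[ℝ] H) with hW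
  set V : H →L[ℝ] H := (U : H →L[ℝ] H) with hVdef
  have hVW : ∀ x, V (W x) = x := fun x => by
    have h : V * W = 1 := U.mul_inv
    simpa using congrArg (fun A : H →L[ℝ] H => A x) h
  set K : ℝ := ‖W‖ + 1 with hK
  have hKpos : 0 < K := by positivity
  refine ⟨K⁻¹, inv_pos.2 hKpos, fun x => ?_⟩
  have h1 : 0 ≤ ⟪K • x - W x, V (K • x - W x)⟫ := hV.inner_nonneg_right _
  have h2 : ⟪W x, V x⟫ = ‖x‖ ^ 2 := by
    have := hV.inner_left_eq_inner_right (W x) x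
    rw [← this, hVW, real_inner_self_eq_norm_sq]
  have h3 : ⟪W x, x⟫ ≤ K * ‖x‖ ^ 2 := by
    calc ⟪W x, x⟫ ≤ ‖W x‖ * ‖x‖ := real_inner_le_norm _ _
      _ ≤ (‖W‖ * ‖x‖) * ‖x‖ := by gcongr; exact W.le_opNorm x
      _ ≤ K * ‖x‖ ^ 2 := by rw [hK]; nlinarith [sq_nonneg ‖x‖]
  have h4 : ⟪K • x - W x, V (K • x - W x)⟫ =
      K ^ 2 * ⟪x, V x⟫ - 2 * K * ‖x‖ ^ 2 + ⟪W x, x⟫ := by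
    simp only [map_sub, map_smul, hVW, inner_sub_left, inner_sub_right, inner_smul_left,
      inner_smul_right, h2, real_inner_self_eq_norm_sq, conj_trivial]
    ring
  have h5 : K * (‖x‖ ^ 2) ≤ K * (K * ⟪x, V x⟫) := by nlinarith
  have h6 := le_of_mul_le_mul_left h5 hKpos
  rw [inv_mul_le_iff₀ hKpos]
  exact h6

variable [CompleteSpace H]

/-- The regularized Gram operator `V_T = M* Σ⁻¹ M + V₀`. -/
def gramOp {T : ℕ} (V₀ : H →L[ℝ] H) (u : Fin T → H) (r : Fin T → ℝ) : H →L[ℝ] H :=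
  ContinuousLinearMap.adjoint (designOp u) ∘L Ring.inverse (noiseOp r) ∘L designOp u + V₀

/-- The operator `Σ + M V₀⁻¹ M*` on Euclidean `ℝ^T`. -/
def kernelOp {T : ℕ} (V₀ : H →L[ℝ] H) (u : Fin T → H) (r : Fin T → ℝ) :
    EuclideanSpace ℝ (Fin T) →L[ℝ] EuclideanSpace ℝ (Fin T) :=
  noiseOp r + designOp u ∘L Ring.inverse V₀ ∘L ContinuousLinearMap.adjoint (designOp u)

/-! Well-definedness of the estimator and of the inverse of `V_T`. -/

theorem isUnit_of_coercive {A : H →L[ℝ] H} {c : ℝ} (hc : 0 < c)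
    (h : ∀ x, c * ‖x‖ ^ 2 ≤ ⟪x, A x⟫) : IsUnit A := by
  refine ContinuousLinearMap.isUnit_of_forall_le_norm_inner_map A (c := ⟨c, hc.le⟩) hc fun x => ?_
  rw [real_inner_comm, mul_comm]
  exact (h x).trans (le_abs_self _)

/-- The operator `V_T` is bounded below, hence invertible. -/
theorem gramOp_coercive {T : ℕ} {V₀ : H →L[ℝ] H} (hV : V₀.IsPositive) (hu : IsUnit V₀)
    (u : Fin T → H) {r : Fin T → ℝ} (hr : ∀ t, 0 < r t) :
    ∃ c : ℝ, 0 < c ∧ ∀ x, c * ‖x‖ ^ 2 ≤ ⟪x, gramOp V₀ u r x⟫ := by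
  obtain ⟨c, hc, h⟩ := coercive_of_isPositive_of_isUnit hV hu
  refine ⟨c, hc, fun x => (h x).trans ?_⟩
  have h0 := (isPositive_ringInverse_noiseOp hr).inner_nonneg_right (designOp u x)
  simp only [gramOp, add_apply, ContinuousLinearMap.comp_apply,
    inner_add_right, ContinuousLinearMap.adjoint_inner_right]
  linarith

theorem isUnit_gramOp {T : ℕ} {V₀ : H →L[ℝ] H} (hV : V₀.IsPositive) (hu : IsUnit V₀)
    (u : Fin T → H) {r : Fin T → ℝ} (hr : ∀ t, 0 < r t) : IsUnit (gramOp V₀ u r) := by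
  obtain ⟨c, hc, h⟩ := gramOp_coercive hV hu u hr
  exact isUnit_of_coercive hc h

/-- Completing the square around any solution `g` of the normal equation. -/
theorem objective_eq {T : ℕ} {V₀ : H →L[ℝ] H} (hV : V₀.IsPositive)
    (u : Fin T → H) {r : Fin T → ℝ} (hr : ∀ t, 0 < r t) (z : EuclideanSpace ℝ (Fin T)) {g : H}
    (hg : gramOp V₀ u r g =
      ContinuousLinearMap.adjoint (designOp u) (Ring.inverse (noiseOp r) z)) (f : H) :
    objective V₀ u r z f = objective V₀ u r z g + ⟪f - g, gramOp V₀ u r (f - g)⟫ := by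
  have hP := isPositive_ringInverse_noiseOp hr
  obtain ⟨d, rfl⟩ : ∃ d, f = g + d := ⟨f - g, by abel⟩
  have hd := congrArg (fun a => ⟪d, a⟫) hg
  simp only [gramOp, add_apply, ContinuousLinearMap.comp_apply,
    inner_add_right, ContinuousLinearMap.adjoint_inner_right] at hd
  have e1 := hV.inner_left_eq_inner_right g d
  have e2 := hP.inner_left_eq_inner_right (designOp u g) (designOp u d)
  have e3 := hP.inner_left_eq_inner_right z (designOp u d)
  rw [real_inner_comm] at e1 e2 e3
  unfold objective weightedNorm
  rw [Real.sq_sqrt (hP.inner_nonneg_right _), Real.sq_sqrt (hV.inner_nonneg_right _),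
    Real.sq_sqrt (hP.inner_nonneg_right _), Real.sq_sqrt (hV.inner_nonneg_right _)]
  simp only [gramOp, add_apply, ContinuousLinearMap.comp_apply, map_add,
    map_sub, inner_add_right, inner_sub_right, inner_add_left, inner_sub_left,
    ContinuousLinearMap.adjoint_inner_right, add_sub_cancel_left]
  linarith

theorem isMinOn_closedForm {T : ℕ} {V₀ : H →L[ℝ] H} (hV : V₀.IsPositive) (hu : IsUnit V₀)
    (u : Fin T → H) {r : Fin T → ℝ} (hr : ∀ t, 0 < r t) (z : EuclideanSpace ℝ (Fin T)) (f : H) :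
    IsMinOn (objective V₀ u r z) Set.univ f ↔
      f = Ring.inverse (gramOp V₀ u r)
        (ContinuousLinearMap.adjoint (designOp u) (Ring.inverse (noiseOp r) z)) := by
  obtain ⟨c, hc, h⟩ := gramOp_coercive hV hu u hr
  set g := Ring.inverse (gramOp V₀ u r)
    (ContinuousLinearMap.adjoint (designOp u) (Ring.inverse (noiseOp r) z)) with hgdef
  have hg : gramOp V₀ u r g =
      ContinuousLinearMap.adjoint (designOp u) (Ring.inverse (noiseOp r) z) := by
    have h1 := Ring.mul_inverse_cancel _ (isUnit_gramOp hV hu u hr)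
    exact congrArg (fun A : H →L[ℝ] H => A
      (ContinuousLinearMap.adjoint (designOp u) (Ring.inverse (noiseOp r) z))) h1
  have key := objective_eq hV u hr z hg
  constructor
  · intro hf
    have h1 := isMinOn_univ_iff.1 hf g
    have h2 := h (f - g)
    have h3 : ‖f - g‖ ^ 2 ≤ 0 := by
      have := key f
      by_contra hlt
      push Not at hlt
      nlinarith [mul_pos hc hlt]
    have h4 : ‖f - g‖ = 0 := by nlinarith [norm_nonneg (f - g), sq_nonneg ‖f - g‖]
    exact sub_eq_zero.1 (norm_eq_zero.1 h4)
  · rintro rfl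
    refine isMinOn_univ_iff.2 fun f => ?_
    have h2 := h (f - g)
    have := key f
    have : 0 ≤ c * ‖f - g‖ ^ 2 := by positivity
    linarith

/-- The estimator is the unique minimizer of the objective, in closed form
`V_T⁻¹ M* Σ⁻¹ z`. -/
theorem estimator_spec {T : ℕ} {V₀ : H →L[ℝ] H} (hV : V₀.IsPositive) (hu : IsUnit V₀)
    (u : Fin T → H) {r : Fin T → ℝ} (hr : ∀ t, 0 < r t) (z : EuclideanSpace ℝ (Fin T)) :
    (∀ f, IsMinOn (objective V₀ u r z) Set.univ f ↔ f = estimator V₀ u r z) ∧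
      estimator V₀ u r z = Ring.inverse (gramOp V₀ u r)
        (ContinuousLinearMap.adjoint (designOp u) (Ring.inverse (noiseOp r) z)) := by
  have key := isMinOn_closedForm hV hu u hr z
  have h1 : estimator V₀ u r z = Ring.inverse (gramOp V₀ u r)
        (ContinuousLinearMap.adjoint (designOp u) (Ring.inverse (noiseOp r) z)) :=
    (key _).1 (Classical.epsilon_spec
      (p := fun f => IsMinOn (objective V₀ u r z) Set.univ f) ⟨_, (key _).2 rfl⟩)
  exact ⟨fun f => by rw [key f, h1], h1⟩

end

end HetLS

/-! Write S_T = M* Σ⁻¹ ε for the score of the noise. The normal equation gives V_T (μ̂_T - f*) = S_T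
- V₀ f*, so Cauchy–Schwarz for ⟨·, V_T⁻¹ ·⟩ bounds the error by ‖v‖_{V_T⁻¹} (‖S_T‖_{V_T⁻¹} +
‖f*‖_{V₀}), the last term because V_T ≥ V₀ (`abs_inner_estimator_sub_le`).

The score is controlled by the method of mixtures. The process Z_T = (det (Σ + M V₀⁻¹ M*) / det
Σ)^(-1/2) exp (‖S_T‖²_{V_T⁻¹} / 2) is a nonnegative supermartingale with Z_0 = 1, so by Ville's
inequality it stays below 1/δ for all T at once, off an event of probability at most δ; taking
logarithms gives the radius.

In infinite dimension no Gaussian law on H has covariance V₀⁻¹, so the mixing is done one round at a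
time. By Sherman–Morrison and the determinant recursion, Z_{T+1} / Z_T (`mixture_succ`) is exactly
the average of exp (ρ⁻² (g ε - g² / 2)) over a real Gaussian g with mean ⟨v_T, V_T⁻¹ S_T⟩ and
variance ‖v_T‖²_{V_T⁻¹}, both known before ε_T (`lintegral_exp_gaussianReal`). Subgaussianity bounds
its conditional mean by one (`lintegral_mul_mixture_le`). -/

namespace HetLS

open Filter Topology
open scoped ENNReal

/-! ### Conditional subgaussianity, Ville's inequality and one-dimensional Gaussian mixing -/

section Probability

variable {Ω : Type*} {m m₀ : MeasurableSpace Ω} {μ : Measure[m₀] Ω}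

/-- A bound on a conditional expectation may be integrated against measurable weights. -/
theorem lintegral_mul_le_of_condLExp_le [IsFiniteMeasure μ] (hm : m ≤ m₀)
    {X Y f : Ω → ℝ≥0∞} (hX : Measurable X) (hY : Measurable Y) (hf : Measurable[m] f)
    (h : μ⁻[X|m] ≤ᵐ[μ] Y) :
    ∫⁻ ω, X ω * f ω ∂μ ≤ ∫⁻ ω, Y ω * f ω ∂μ := by
  -- Since `f` is `m`-measurable, it only sees the measures X μ and Y μ on `m`-sets, where the
  -- conditional expectation compares them.
  have hle : (μ.withDensity X).trim hm ≤ (μ.withDensity Y).trim hm := by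
    refine Measure.le_intro fun s hs _ => ?_
    rw [trim_measurableSet_eq hm hs, trim_measurableSet_eq hm hs,
      withDensity_apply _ (hm s hs), withDensity_apply _ (hm s hs),
      ← setLIntegral_condLExp hm μ X hs]
    exact setLIntegral_mono_ae' (hm s hs) (h.mono fun ω hω _ => hω)
  have key : ∀ {Z : Ω → ℝ≥0∞}, Measurable Z →
      ∫⁻ ω, Z ω * f ω ∂μ = ∫⁻ ω, f ω ∂(μ.withDensity Z).trim hm := fun {Z} hZ => by
    rw [lintegral_trim hm hf, lintegral_withDensity_eq_lintegral_mul _ hZ (hf.mono hm le_rfl)]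
    rfl
  rw [key hX, key hY]
  exact lintegral_mono' hle le_rfl

/-- The exponential weights `exp (L ε - L² ρ² / 2)` have conditional mean at most one for every
`m`-measurable `L` when `ε` is conditionally `ρ`-subgaussian. -/
theorem lintegral_mul_exp_le [IsFiniteMeasure μ] (hm : m ≤ m₀) {ρ ε : Ω → ℝ}
    (hρ : Measurable[m] ρ) (hε : Measurable ε)
    (hsub : ∀ l : ℝ, μ⁻[fun ω => ENNReal.ofReal (Real.exp (l * ε ω)) | m] ≤ᵐ[μ]
      fun ω => ENNReal.ofReal (Real.exp (l ^ 2 * ρ ω ^ 2 / 2)))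
    {L : Ω → ℝ} (hL : Measurable[m] L) {f : Ω → ℝ≥0∞} (hf : Measurable[m] f) :
    ∫⁻ ω, f ω * ENNReal.ofReal (Real.exp (L ω * ε ω - L ω ^ 2 * ρ ω ^ 2 / 2)) ∂μ
      ≤ ∫⁻ ω, f ω ∂μ := by
  have hρ' : Measurable ρ := hρ.mono hm le_rfl
  have hconst : ∀ (l : ℝ) (g : Ω → ℝ≥0∞), Measurable[m] g →
      ∫⁻ ω, g ω * ENNReal.ofReal (Real.exp (l * ε ω - l ^ 2 * ρ ω ^ 2 / 2)) ∂μ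
        ≤ ∫⁻ ω, g ω ∂μ := by
    intro l g hg
    have hmeas : Measurable[m] fun ω =>
        ENNReal.ofReal (Real.exp (-(l ^ 2 * ρ ω ^ 2 / 2))) * g ω := by fun_prop
    have h1 := lintegral_mul_le_of_condLExp_le hm (X := fun ω =>
      ENNReal.ofReal (Real.exp (l * ε ω))) (by fun_prop) (by fun_prop) hmeas (hsub l)
    refine (le_of_eq ?_).trans (h1.trans (le_of_eq ?_))
    · refine lintegral_congr fun ω => ?_
      rw [← mul_assoc, ← ENNReal.ofReal_mul (Real.exp_nonneg _), ← Real.exp_add, mul_comm,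
        sub_eq_add_neg]
    · refine lintegral_congr fun ω => ?_
      rw [← mul_assoc, ← ENNReal.ofReal_mul (Real.exp_nonneg _), ← Real.exp_add]
      simp
  -- The hypothesis holds for each fixed `l` off a null set depending on `l`, so `L` cannot be
  -- substituted pointwise. For finitely many values, the level sets are in `m` and are absorbed
  -- into the weight.
  have hsimple : ∀ (φ : Ω → ℝ) (R : Finset ℝ), Measurable[m] φ → (∀ ω, φ ω ∈ R) →
      ∫⁻ ω, f ω * ENNReal.ofReal (Real.exp (φ ω * ε ω - φ ω ^ 2 * ρ ω ^ 2 / 2)) ∂μ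
        ≤ ∫⁻ ω, f ω ∂μ := by
    intro φ R hφ hR
    have hfib : ∀ l, MeasurableSet[m] (φ ⁻¹' {l}) := fun l => hφ (measurableSet_singleton l)
    have hsum : ∀ g : Ω → ℝ≥0∞,
        (fun ω => ∑ l ∈ R, (φ ⁻¹' {l}).indicator g ω) = g := by
      intro g
      ext ω
      rw [Finset.sum_eq_single (φ ω)]
      · exact Set.indicator_of_mem (show ω ∈ φ ⁻¹' {φ ω} from rfl) g
      · exact fun l _ hl => Set.indicator_of_notMem (fun h => hl (by simpa using h.symm)) _
      · exact fun h => absurd (hR ω) h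
    have hdecomp : ∀ ω, f ω * ENNReal.ofReal (Real.exp (φ ω * ε ω - φ ω ^ 2 * ρ ω ^ 2 / 2)) =
        ∑ l ∈ R, (φ ⁻¹' {l}).indicator f ω *
          ENNReal.ofReal (Real.exp (l * ε ω - l ^ 2 * ρ ω ^ 2 / 2)) := by
      intro ω
      rw [← congrFun (hsum fun ω => f ω *
        ENNReal.ofReal (Real.exp (φ ω * ε ω - φ ω ^ 2 * ρ ω ^ 2 / 2))) ω]
      refine Finset.sum_congr rfl fun l _ => ?_
      by_cases h : ω ∈ φ ⁻¹' {l}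
      · have h' : φ ω = l := h
        rw [Set.indicator_of_mem h, Set.indicator_of_mem h, h']
      · rw [Set.indicator_of_notMem h, Set.indicator_of_notMem h, zero_mul]
    have hmi : ∀ l, Measurable[m] ((φ ⁻¹' {l}).indicator f) := fun l => hf.indicator (hfib l)
    calc _ = ∑ l ∈ R, ∫⁻ ω, (φ ⁻¹' {l}).indicator f ω *
          ENNReal.ofReal (Real.exp (l * ε ω - l ^ 2 * ρ ω ^ 2 / 2)) ∂μ := by
          simp_rw [hdecomp]
          refine lintegral_finsetSum _ fun l _ => ?_
          have := (hmi l).mono hm le_rfl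
          fun_prop
      _ ≤ ∑ l ∈ R, ∫⁻ ω, (φ ⁻¹' {l}).indicator f ω ∂μ :=
          Finset.sum_le_sum fun l _ => hconst l _ (hmi l)
      _ = ∫⁻ ω, f ω ∂μ := by
          rw [← lintegral_finsetSum _ fun l _ => (hmi l).mono hm le_rfl]
          simp_rw [congrFun (hsum f)]
  -- General `L`: approximate by simple functions and use Fatou, which needs no domination.
  have hLs : StronglyMeasurable[m] L := hL.stronglyMeasurable
  set φ := hLs.approx with hφ
  have hlim : ∀ ω, Tendsto (fun n => f ω *
      ENNReal.ofReal (Real.exp (φ n ω * ε ω - φ n ω ^ 2 * ρ ω ^ 2 / 2))) atTop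
      (𝓝 (f ω * ENNReal.ofReal (Real.exp (L ω * ε ω - L ω ^ 2 * ρ ω ^ 2 / 2)))) := by
    intro ω
    have hc : Continuous fun x : ℝ =>
      ENNReal.ofReal (Real.exp (x * ε ω - x ^ 2 * ρ ω ^ 2 / 2)) :=
      ENNReal.continuous_ofReal.comp (by fun_prop)
    -- The weight may be infinite; the limit is still legitimate because the exponential never
    -- vanishes.
    refine ENNReal.Tendsto.const_mul ((hc.tendsto _).comp (hLs.tendsto_approx ω)) (Or.inl ?_)
    simp [Real.exp_pos]
  calc _ = ∫⁻ ω, liminf (fun n => f ω *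
        ENNReal.ofReal (Real.exp (φ n ω * ε ω - φ n ω ^ 2 * ρ ω ^ 2 / 2))) atTop ∂μ :=
        lintegral_congr fun ω => (hlim ω).liminf_eq.symm
    _ ≤ liminf (fun n => ∫⁻ ω, f ω *
        ENNReal.ofReal (Real.exp (φ n ω * ε ω - φ n ω ^ 2 * ρ ω ^ 2 / 2)) ∂μ) atTop := by
        refine lintegral_liminf_le fun n => ?_
        have h1 : Measurable (φ n) := (@SimpleFunc.measurable _ _ m _ (φ n)).mono hm le_rfl
        have h2 := hf.mono hm le_rfl
        fun_prop
    _ ≤ _ := by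
        refine (liminf_le_liminf (Eventually.of_forall fun n => hsimple (φ n) _
          (@SimpleFunc.measurable _ _ m _ (φ n)) (@SimpleFunc.mem_range_self _ _ m (φ n)))).trans ?_
        simp

/-- Ville's inequality for a nonnegative supermartingale, in `ℝ≥0∞`. -/
theorem mul_measure_exists_le_le {𝓕 : Filtration ℕ m₀} {Z : ℕ → Ω → ℝ≥0∞}
    (hZ : ∀ n, Measurable[𝓕 n] (Z n))
    (hstep : ∀ n (A : Set Ω), MeasurableSet[𝓕 n] A →
      ∫⁻ ω in A, Z (n + 1) ω ∂μ ≤ ∫⁻ ω in A, Z n ω ∂μ) (c : ℝ≥0∞) :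
    c * μ {ω | ∃ n, c ≤ Z n ω} ≤ ∫⁻ ω, Z 0 ω ∂μ := by
  set C : ℕ → Set Ω := fun n => {ω | c ≤ Z n ω} with hC
  set B : ℕ → Set Ω := fun n => {ω | ∃ k ≤ n, c ≤ Z k ω} with hB
  have hCm : ∀ n, MeasurableSet[𝓕 n] (C n) := fun n =>
    hZ n measurableSet_Ici
  have hBsucc : ∀ n, B (n + 1) = B n ∪ (C (n + 1) \ B n) := by
    intro n
    ext ω
    simp only [hB, hC, Set.mem_ofPred_eq, Set.mem_union, Set.mem_sdiff]
    constructor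
    · rintro ⟨k, hk, h⟩
      by_cases hb : ∃ k ≤ n, c ≤ Z k ω
      · exact Or.inl hb
      · rcases Nat.le_succ_iff.1 hk with hk | rfl
        · exact absurd ⟨k, hk, h⟩ hb
        · exact Or.inr ⟨h, hb⟩
    · rintro (⟨k, hk, h⟩ | ⟨h, -⟩)
      · exact ⟨k, hk.trans n.le_succ, h⟩
      · exact ⟨n + 1, le_rfl, h⟩
  have hB0 : B 0 = C 0 := by ext ω; simp [hB, hC]
  have hBm : ∀ n, MeasurableSet[𝓕 n] (B n) := by
    intro n
    induction n with
    | zero => rw [hB0]; exact hCm 0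
    | succ n ih =>
      have ih' := 𝓕.mono n.le_succ _ ih
      rw [hBsucc]
      exact ih'.union ((hCm _).diff ih')
  have hle := 𝓕.le
  have hcC : ∀ n (D : Set Ω), D ⊆ C n → MeasurableSet D → c * μ D ≤ ∫⁻ ω in D, Z n ω ∂μ := by
    intro n D hD hDm
    rw [← setLIntegral_const]
    exact setLIntegral_mono ((hZ n).mono (hle n) le_rfl) fun ω hω => hD hω
  -- This is the supermartingale stopped at its first crossing of `c`: paths in `B n` have crossed
  -- and are charged `c`, the others still carry `Z n`. At each step the new crossings are split off
  -- from the complement.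
  have hmain : ∀ n, c * μ (B n) + ∫⁻ ω in (B n)ᶜ, Z n ω ∂μ ≤ ∫⁻ ω, Z 0 ω ∂μ := by
    intro n
    induction n with
    | zero =>
      have hm := hle 0 _ (hBm 0)
      exact (add_le_add (hcC 0 _ hB0.le hm) le_rfl).trans (lintegral_add_compl (Z 0) hm).le
    | succ n ih =>
      refine le_trans ?_ ih
      have hm := hle _ _ (hBm n)
      have hCm' := hle _ _ (hCm (n + 1))
      have hd : MeasurableSet (C (n + 1) \ B n) := hCm'.diff hm
      have hcompl : (B n)ᶜ = (C (n + 1) \ B n) ∪ (B (n + 1))ᶜ := by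
        rw [hBsucc]
        ext ω
        simp only [Set.mem_compl_iff, Set.mem_union, Set.mem_sdiff]
        tauto
      have hdisj : Disjoint (C (n + 1) \ B n) (B (n + 1))ᶜ := by
        rw [hBsucc]
        refine Set.disjoint_left.2 fun ω h1 h2 => h2 (Or.inr h1)
      have h1 := hstep n (B n)ᶜ (hBm n).compl
      rw [hcompl, lintegral_union (hle _ _ (hBm (n + 1))).compl hdisj, ← hcompl] at h1
      have h2 := hcC (n + 1) _ Set.sdiff_subset hd
      calc c * μ (B (n + 1)) + ∫⁻ ω in (B (n + 1))ᶜ, Z (n + 1) ω ∂μ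
          = c * μ (B n) + (c * μ (C (n + 1) \ B n) +
              ∫⁻ ω in (B (n + 1))ᶜ, Z (n + 1) ω ∂μ) := by
            conv_lhs => rw [hBsucc, measure_union Set.disjoint_sdiff_right hd, ← hBsucc]
            rw [mul_add, add_assoc]
        _ ≤ _ := by gcongr; exact (add_le_add h2 le_rfl).trans h1
  have hU : {ω | ∃ n, c ≤ Z n ω} = ⋃ n, B n := by
    ext ω
    simp only [hB, Set.mem_ofPred_eq, Set.mem_iUnion]
    exact ⟨fun ⟨n, h⟩ => ⟨n, n, le_rfl, h⟩, fun ⟨_, k, _, h⟩ => ⟨k, h⟩⟩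
  have hmono : Monotone B := fun a b hab ω ⟨k, hk, h⟩ => ⟨k, hk.trans hab, h⟩
  rw [hU, hmono.measure_iUnion, ENNReal.mul_iSup]
  exact iSup_le fun n => le_self_add.trans (hmain n)

/-- The Gaussian average of `exp (τ (g ε - g² / 2))` over `g = b + s z`. -/
theorem lintegral_exp_gaussianReal {τ : ℝ} (hτ : 0 ≤ τ) (b s e : ℝ) :
    ∫⁻ z, ENNReal.ofReal (Real.exp (τ * ((b + s * z) * e - (b + s * z) ^ 2 / 2)))
        ∂gaussianReal 0 1 =
      ENNReal.ofReal ((Real.sqrt (1 + τ * s ^ 2))⁻¹ * Real.exp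
        ((2 * τ * e * b + τ ^ 2 * e ^ 2 * s ^ 2 - τ * b ^ 2) / (1 + τ * s ^ 2) / 2)) := by
  set D : ℝ := 1 + τ * s ^ 2 with hD
  have hDpos : 0 < D := by positivity
  set V : NNReal := ⟨D⁻¹, (inv_pos.2 hDpos).le⟩ with hVd
  have hV : V ≠ 0 := fun h => (inv_pos.2 hDpos).ne' (congrArg NNReal.toReal h)
  have hVc : (V : ℝ) = D⁻¹ := rfl
  set C : ℝ := (Real.sqrt D)⁻¹ * Real.exp
        ((2 * τ * e * b + τ ^ 2 * e ^ 2 * s ^ 2 - τ * b ^ 2) / D / 2) with hCd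
  have hC : 0 ≤ C := by positivity
  -- Completing the square in `z`: the tilted standard density is a constant times the density with
  -- mean τ s (e - b) / D and variance 1 / D.
  have hpt : ∀ z, gaussianPDF 0 1 z *
      ENNReal.ofReal (Real.exp (τ * ((b + s * z) * e - (b + s * z) ^ 2 / 2))) =
      ENNReal.ofReal C * gaussianPDF (τ * s * (e - b) / D) V z := by
    intro z
    rw [gaussianPDF, gaussianPDF, ← ENNReal.ofReal_mul (gaussianPDFReal_nonneg _ _ _),
      ← ENNReal.ofReal_mul hC]
    congr 1
    rw [gaussianPDFReal, gaussianPDFReal, hCd, hVc]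
    have hs : Real.sqrt (2 * Real.pi * D⁻¹) = Real.sqrt (2 * Real.pi) * (Real.sqrt D)⁻¹ := by
      rw [Real.sqrt_mul (by positivity), Real.sqrt_inv]
    have hsD : Real.sqrt D ≠ 0 := (Real.sqrt_pos.2 hDpos).ne'
    have hexp : Real.exp (-(z - 0) ^ 2 / (2 * ((1 : NNReal) : ℝ))) *
        Real.exp (τ * ((b + s * z) * e - (b + s * z) ^ 2 / 2)) =
        Real.exp ((2 * τ * e * b + τ ^ 2 * e ^ 2 * s ^ 2 - τ * b ^ 2) / D / 2) *
        Real.exp (-(z - τ * s * (e - b) / D) ^ 2 / (2 * D⁻¹)) := by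
      rw [← Real.exp_add, ← Real.exp_add]
      congr 1
      simp only [NNReal.coe_one]
      field_simp
      rw [hD]
      ring
    rw [mul_assoc, hexp, hs]
    simp only [NNReal.coe_one, mul_one, mul_inv, inv_inv]
    field_simp
  rw [gaussianReal_of_var_ne_zero _ one_ne_zero,
    lintegral_withDensity_eq_lintegral_mul _ (measurable_gaussianPDF _ _) (by fun_prop)]
  simp only [Pi.mul_apply, hpt]
  rw [lintegral_const_mul _ (measurable_gaussianPDF _ _), lintegral_gaussianPDF_eq_one _ hV,
    mul_one]

/-- One step of the method of mixtures: averaging `exp (L ε - L² ρ² / 2)` over a Gaussian `L`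
with `m`-measurable mean and variance. -/
theorem lintegral_mul_mixture_le [IsFiniteMeasure μ] (hm : m ≤ m₀) {ρ ε b s : Ω → ℝ}
    (hρ : Measurable[m] ρ) (hρpos : ∀ ω, 0 < ρ ω) (hε : Measurable ε)
    (hb : Measurable[m] b) (hs : Measurable[m] s)
    (hsub : ∀ l : ℝ, μ⁻[fun ω => ENNReal.ofReal (Real.exp (l * ε ω)) | m] ≤ᵐ[μ]
      fun ω => ENNReal.ofReal (Real.exp (l ^ 2 * ρ ω ^ 2 / 2)))
    {f : Ω → ℝ≥0∞} (hf : Measurable[m] f) :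
    ∫⁻ ω, f ω * ENNReal.ofReal ((Real.sqrt (1 + (ρ ω ^ 2)⁻¹ * s ω ^ 2))⁻¹ * Real.exp
        ((2 * (ρ ω ^ 2)⁻¹ * ε ω * b ω + ((ρ ω ^ 2)⁻¹) ^ 2 * ε ω ^ 2 * s ω ^ 2
          - (ρ ω ^ 2)⁻¹ * b ω ^ 2) / (1 + (ρ ω ^ 2)⁻¹ * s ω ^ 2) / 2)) ∂μ
      ≤ ∫⁻ ω, f ω ∂μ := by
  have hρ' := hρ.mono hm le_rfl
  have hb' := hb.mono hm le_rfl
  have hs' := hs.mono hm le_rfl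
  have hf' := hf.mono hm le_rfl
  have hmeas : Measurable (Function.uncurry fun (ω : Ω) (z : ℝ) => f ω *
      ENNReal.ofReal (Real.exp ((ρ ω ^ 2)⁻¹ *
        ((b ω + s ω * z) * ε ω - (b ω + s ω * z) ^ 2 / 2)))) := by
    unfold Function.uncurry
    fun_prop
  calc _ = ∫⁻ ω, ∫⁻ z, f ω * ENNReal.ofReal (Real.exp ((ρ ω ^ 2)⁻¹ *
          ((b ω + s ω * z) * ε ω - (b ω + s ω * z) ^ 2 / 2))) ∂gaussianReal 0 1 ∂μ := by
        refine lintegral_congr fun ω => ?_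
        rw [lintegral_const_mul _ (by fun_prop), lintegral_exp_gaussianReal (by positivity)]
    _ = ∫⁻ z, ∫⁻ ω, f ω * ENNReal.ofReal (Real.exp ((ρ ω ^ 2)⁻¹ *
          ((b ω + s ω * z) * ε ω - (b ω + s ω * z) ^ 2 / 2))) ∂μ ∂gaussianReal 0 1 :=
        lintegral_lintegral_swap hmeas.aemeasurable
    _ ≤ ∫⁻ _, ∫⁻ ω, f ω ∂μ ∂gaussianReal 0 1 := by
        refine lintegral_mono fun z => ?_
        -- For frozen `z`, the choice L = ρ⁻² g with g = b + s z turns L ε - L² ρ² / 2 into ρ⁻² (g ε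
        -- - g² / 2).
        have hL : Measurable[m] fun ω => (ρ ω ^ 2)⁻¹ * (b ω + s ω * z) := by fun_prop
        refine le_trans (le_of_eq (lintegral_congr fun ω => ?_))
          (lintegral_mul_exp_le hm hρ hε hsub hL hf)
        have := (hρpos ω).ne'
        congr 3
        field_simp
    _ = _ := by simp

end Probability

/-! ### Seminorms of positive operators -/

section WeightedNorm

variable {E : Type*} [NormedAddCommGroup E] [InnerProductSpace ℝ E] {A : E →L[ℝ] E}

theorem weightedNorm_nonneg (x : E) : 0 ≤ weightedNorm A x := Real.sqrt_nonneg _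

theorem sq_weightedNorm (hA : A.IsPositive) (x : E) : weightedNorm A x ^ 2 = ⟪x, A x⟫ :=
  Real.sq_sqrt (hA.inner_nonneg_right x)

/-- The Cauchy–Schwarz inequality for the semi-inner product of a positive operator. -/
theorem abs_inner_le_weightedNorm_mul (hA : A.IsPositive) (x y : E) :
    |⟪x, A y⟫| ≤ weightedNorm A x * weightedNorm A y := by
  have hsym : ⟪y, A x⟫ = ⟪x, A y⟫ := by
    rw [← hA.inner_left_eq_inner_right, real_inner_comm]
  have hd : discrim ⟪y, A y⟫ (2 * ⟪x, A y⟫) ⟪x, A x⟫ ≤ 0 := by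
    refine discrim_le_zero fun t => ?_
    have h := hA.inner_nonneg_right (x + t • y)
    simp only [map_add, map_smul, inner_add_left, inner_add_right, inner_smul_left,
      inner_smul_right, conj_trivial, hsym] at h
    linarith
  refine abs_le_of_sq_le_sq ?_ (mul_nonneg (weightedNorm_nonneg x) (weightedNorm_nonneg y))
  rw [mul_pow, sq_weightedNorm hA, sq_weightedNorm hA]
  rw [discrim] at hd
  linarith

theorem weightedNorm_sub_le (hA : A.IsPositive) (x y : E) :
    weightedNorm A (x - y) ≤ weightedNorm A x + weightedNorm A y := by
  have h := (neg_abs_le _).trans' (neg_le_neg (abs_inner_le_weightedNorm_mul hA x y))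
  have hsym : ⟪y, A x⟫ = ⟪x, A y⟫ := by
    rw [← hA.inner_left_eq_inner_right, real_inner_comm]
  refine le_of_sq_le_sq ?_ (add_nonneg (weightedNorm_nonneg x) (weightedNorm_nonneg y))
  have e := sq_weightedNorm hA (x - y)
  simp only [map_sub, inner_sub_left, inner_sub_right, hsym] at e
  rw [e]
  linarith [sq_weightedNorm hA x, sq_weightedNorm hA y]

end WeightedNorm

/-! ### Inverses of positive operators and rank-one updates -/

section Inverse

variable {H : Type*} [NormedAddCommGroup H] [InnerProductSpace ℝ H] {A : H →L[ℝ] H}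

theorem apply_ringInverse (hA : IsUnit A) (x : H) : A (Ring.inverse A x) = x :=
  DFunLike.congr_fun (Ring.mul_inverse_cancel A hA) x

theorem ringInverse_apply (hA : IsUnit A) (x : H) : Ring.inverse A (A x) = x :=
  DFunLike.congr_fun (Ring.inverse_mul_cancel A hA) x

theorem inner_ringInverse (hA : A.IsPositive) (hu : IsUnit A) (x y : H) :
    ⟪x, Ring.inverse A y⟫ = ⟪Ring.inverse A x, y⟫ := by
  conv_lhs => rw [← apply_ringInverse hu x]
  rw [hA.inner_left_eq_inner_right, apply_ringInverse hu]

theorem isPositive_ringInverse (hA : A.IsPositive) (hu : IsUnit A) :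
    (Ring.inverse A).IsPositive := by
  refine (ContinuousLinearMap.isPositive_iff _).2
    ⟨fun x y => (inner_ringInverse hA hu x y).symm, fun x => ?_⟩
  rw [← inner_ringInverse hA hu]
  conv_rhs => rw [inner_ringInverse hA hu, ← apply_ringInverse hu x, ringInverse_apply hu]
  exact hA.inner_nonneg_right _

variable {B : H →L[ℝ] H} {τ : ℝ} {v : H}

/-- The Sherman–Morrison formula for a rank-one update. -/
theorem ringInverse_rankOne_update (hA : A.IsPositive) (hu : IsUnit A) (hB : IsUnit B)
    (hτ : 0 ≤ τ) (h : ∀ x, B x = A x + (τ * ⟪v, x⟫) • v) (x : H) :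
    Ring.inverse B x = Ring.inverse A x -
      (τ * ⟪v, Ring.inverse A x⟫ / (1 + τ * ⟪v, Ring.inverse A v⟫)) • Ring.inverse A v := by
  have hpos : 0 < 1 + τ * ⟪v, Ring.inverse A v⟫ := by
    have := mul_nonneg hτ ((isPositive_ringInverse hA hu).inner_nonneg_right v)
    linarith
  rw [← ringInverse_apply hB (Ring.inverse A x - _)]
  congr 1
  rw [h, map_sub, map_smul, apply_ringInverse hu, apply_ringInverse hu, inner_sub_right,
    inner_smul_right, sub_add, ← sub_smul]
  rw [eq_comm, sub_eq_self]
  convert! zero_smul ℝ v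
  field_simp
  ring

/-- Sherman–Morrison applied to the updated score. With b = ⟨v, A⁻¹ S⟩ and s² = ⟨v, A⁻¹ v⟩, the
increment is twice the exponent produced by `lintegral_exp_gaussianReal`. -/
theorem inner_ringInverse_rankOne_update (hA : A.IsPositive) (hu : IsUnit A) (hB : IsUnit B)
    (hτ : 0 ≤ τ) (h : ∀ x, B x = A x + (τ * ⟪v, x⟫) • v) (S : H) (e : ℝ) :
    ⟪S + (τ * e) • v, Ring.inverse B (S + (τ * e) • v)⟫ = ⟪S, Ring.inverse A S⟫ +
      (2 * τ * e * ⟪v, Ring.inverse A S⟫ + τ ^ 2 * e ^ 2 * ⟪v, Ring.inverse A v⟫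
        - τ * ⟪v, Ring.inverse A S⟫ ^ 2) / (1 + τ * ⟪v, Ring.inverse A v⟫) := by
  have hpos : 0 < 1 + τ * ⟪v, Ring.inverse A v⟫ := by
    have := mul_nonneg hτ ((isPositive_ringInverse hA hu).inner_nonneg_right v)
    linarith
  have hsym : ⟪S, Ring.inverse A v⟫ = ⟪v, Ring.inverse A S⟫ := by
    rw [inner_ringInverse hA hu, real_inner_comm]
  rw [ringInverse_rankOne_update hA hu hB hτ h]
  simp only [map_add, map_smul, inner_add_left, inner_add_right, inner_sub_right,
    inner_smul_left, inner_smul_right, conj_trivial, hsym]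
  field_simp
  ring

end Inverse

/-! ### Gram operator, kernel determinant and estimation error -/

section Gram

variable {H : Type*} [NormedAddCommGroup H] [InnerProductSpace ℝ H] [CompleteSpace H]
  {V₀ : H →L[ℝ] H}

theorem adjoint_designOp_apply {T : ℕ} (u : Fin T → H) (z : EuclideanSpace ℝ (Fin T)) :
    ContinuousLinearMap.adjoint (designOp u) z = ∑ t, z t • u t := by
  refine ext_inner_right ℝ fun x => ?_
  rw [ContinuousLinearMap.adjoint_inner_left, sum_inner, PiLp.inner_apply]
  refine Finset.sum_congr rfl fun t _ => ?_
  rw [designOp_apply, inner_smul_left]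
  simp [mul_comm]

theorem gramOp_apply {T : ℕ} (u : Fin T → H) {r : Fin T → ℝ} (hr : ∀ t, 0 < r t) (x : H) :
    gramOp V₀ u r x = ∑ t, ((r t ^ 2)⁻¹ * ⟪u t, x⟫) • u t + V₀ x := by
  simp only [gramOp, add_apply, ContinuousLinearMap.comp_apply, adjoint_designOp_apply,
    ringInverse_noiseOp_apply hr, designOp_apply]

theorem gramOp_zero_apply (u : Fin 0 → H) (r : Fin 0 → ℝ) : gramOp V₀ u r = V₀ := by
  ext x
  rw [gramOp_apply u (fun t => t.elim0)]
  simp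

theorem gramOp_succ_apply (u : ℕ → H) {r : ℕ → ℝ} (hr : ∀ t, 0 < r t) (T : ℕ) (x : H) :
    gramOp V₀ (fun t : Fin (T + 1) => u t) (fun t => r t) x =
      gramOp V₀ (fun t : Fin T => u t) (fun t => r t) x + ((r T ^ 2)⁻¹ * ⟪u T, x⟫) • u T := by
  rw [gramOp_apply _ fun t => hr t, gramOp_apply _ fun t => hr t, Fin.sum_univ_castSucc]
  simp only [Fin.val_castSucc, Fin.val_last]
  abel

theorem isPositive_gramOp {T : ℕ} (hV : V₀.IsPositive) (u : Fin T → H) {r : Fin T → ℝ}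
    (hr : ∀ t, 0 < r t) : (gramOp V₀ u r).IsPositive := by
  rw [gramOp]
  exact ((isPositive_ringInverse_noiseOp hr).adjoint_conj (designOp u)).add hV

/-- The Gram matrix `Σ + (⟨u_i, V₀⁻¹ u_j⟩)` representing `kernelOp`. -/
noncomputable def kernelMatrix {T : ℕ} (V₀ : H →L[ℝ] H) (u : Fin T → H) (r : Fin T → ℝ) :
    Matrix (Fin T) (Fin T) ℝ :=
  Matrix.diagonal (fun t => r t ^ 2) + Matrix.of fun i j => ⟪u i, Ring.inverse V₀ (u j)⟫

theorem det_toEuclideanCLM {T : ℕ} (K : Matrix (Fin T) (Fin T) ℝ) :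
    (Matrix.toEuclideanCLM (n := Fin T) (𝕜 := ℝ) K).det = K.det := by
  rw [ContinuousLinearMap.det, Matrix.coe_toEuclideanCLM_eq_toEuclideanLin,
    Matrix.toEuclideanLin, Matrix.toLpLin_eq_toLin, LinearMap.det_toLin]

theorem det_noiseOp {T : ℕ} (r : Fin T → ℝ) : (noiseOp r).det = ∏ t, r t ^ 2 := by
  rw [noiseOp, det_toEuclideanCLM, Matrix.det_diagonal]

theorem det_kernelOp {T : ℕ} (u : Fin T → H) (r : Fin T → ℝ) :
    (kernelOp V₀ u r).det = (kernelMatrix V₀ u r).det := by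
  rw [← det_toEuclideanCLM]
  congr 1
  ext z i
  have h : designOp u (Ring.inverse V₀ (ContinuousLinearMap.adjoint (designOp u) z)) i =
      ∑ j, ⟪u i, Ring.inverse V₀ (u j)⟫ * z j := by
    rw [designOp_apply, adjoint_designOp_apply, map_sum, inner_sum]
    simp only [map_smul, inner_smul_right, mul_comm]
  simp only [kernelOp, kernelMatrix, noiseOp, map_add, add_apply,
    ContinuousLinearMap.comp_apply, PiLp.add_apply, h, Matrix.ofLp_toEuclideanCLM, Matrix.mulVec,
    dotProduct, Matrix.of_apply]

/-- Adding a design point multiplies the kernel determinant by `r_T² + ‖u_T‖²_{V_T⁻¹}`. -/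
theorem det_kernelMatrix_succ (hV : V₀.IsPositive) (hu : IsUnit V₀) (u : ℕ → H) {r : ℕ → ℝ}
    (hr : ∀ t, 0 < r t) (T : ℕ) :
    (kernelMatrix V₀ (fun t : Fin (T + 1) => u t) (fun t => r t)).det =
      (kernelMatrix V₀ (fun t : Fin T => u t) (fun t => r t)).det *
        (r T ^ 2 + ⟪u T, Ring.inverse (gramOp V₀ (fun t : Fin T => u t) (fun t => r t)) (u T)⟫) := by
  set K := kernelMatrix V₀ (fun t : Fin T => u t) (fun t => r t) with hK
  set K' := kernelMatrix V₀ (fun t : Fin (T + 1) => u t) (fun t => r t) with hK'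
  set G := gramOp V₀ (fun t : Fin T => u t) (fun t => r t) with hG
  set x := Ring.inverse G (u T) with hx
  -- Here c = Σ⁻¹ M x with V_T x = u_T, that is, u_T = M* c + V₀ x. Subtracting K c from the last
  -- column of the bordered matrix leaves M x - Σ c = 0 above the corner and r_T² + ⟨u_T, x⟩ in it.
  -- This column operation is unipotent, so the determinant is unchanged.
  set c : Fin T → ℝ := fun t => (r t ^ 2)⁻¹ * ⟪u t, x⟫ with hc
  have hGx : ∑ t : Fin T, c t • u t + V₀ x = u T := by
    rw [← gramOp_apply (fun t : Fin T => u t) (fun t => hr t)]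
    exact apply_ringInverse (isUnit_gramOp hV hu _ fun t => hr t) _
  have hx' : Ring.inverse V₀ (u T) = ∑ t : Fin T, c t • Ring.inverse V₀ (u t) + x := by
    conv_lhs => rw [← hGx]
    rw [map_add, map_sum, ringInverse_apply hu]
    simp only [map_smul]
  -- the last column minus the combination of the others with coefficients `c`
  have hcol : ∀ y : H, ⟪y, Ring.inverse V₀ (u T)⟫ -
      ∑ t : Fin T, ⟪y, Ring.inverse V₀ (u t)⟫ * c t = ⟪y, x⟫ := by
    intro y
    rw [hx', inner_add_right, inner_sum]
    simp only [inner_smul_right, mul_comm]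
    ring
  set p : Matrix (Fin 1) (Fin T) ℝ := Matrix.of fun _ j => ⟪u T, Ring.inverse V₀ (u j)⟫ with hp
  set k : Matrix (Fin T) (Fin 1) ℝ := Matrix.of fun i _ => ⟪u i, Ring.inverse V₀ (u T)⟫ with hk
  set d : Matrix (Fin 1) (Fin 1) ℝ :=
    Matrix.of fun _ _ => r T ^ 2 + ⟪u T, Ring.inverse V₀ (u T)⟫ with hd
  set C : Matrix (Fin T) (Fin 1) ℝ := Matrix.of fun i _ => c i with hCd
  have hblock : Matrix.reindex finSumFinEquiv.symm finSumFinEquiv.symm K' =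
      Matrix.fromBlocks K k p d := by
    ext i j
    rcases i with i | i <;> rcases j with j | j
    · simp [hK, hK', kernelMatrix, Matrix.diagonal_apply, Fin.ext_iff]
    · have : (i : ℕ) ≠ T := i.2.ne
      simp [hK', kernelMatrix, Fin.ext_iff, hk, this]
    · have : T ≠ (j : ℕ) := j.2.ne'
      simp [hK', kernelMatrix, Fin.ext_iff, hp, this]
    · have hi : i = 0 := Subsingleton.elim _ _
      have hj : j = 0 := Subsingleton.elim _ _
      subst hi hj
      simp [hK', kernelMatrix, hd]
  have hKC : k - K * C = 0 := by
    ext i j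
    have h1 := hcol (u i)
    have h2 : (r i ^ 2) * c i = ⟪u i, x⟫ := by
      have := (hr i).ne'
      simp only [hc]
      field_simp
    simp only [hK, kernelMatrix, hk, hCd, Matrix.add_mul, Matrix.sub_apply, Matrix.add_apply,
      Matrix.of_apply, Matrix.mul_apply, Matrix.zero_apply, Matrix.diagonal_apply, ite_mul, zero_mul,
      Finset.sum_ite_eq, Finset.mem_univ, if_true]
    linarith
  have hdC : d - p * C = Matrix.of fun _ _ => r T ^ 2 + ⟪u T, x⟫ := by
    ext i j
    have h1 := hcol (u T)
    simp only [hd, hp, hCd, Matrix.sub_apply, Matrix.of_apply, Matrix.mul_apply]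
    linarith
  have hmul : Matrix.fromBlocks K k p d * Matrix.fromBlocks 1 (-C) 0 1 =
      Matrix.fromBlocks K 0 p (Matrix.of fun _ _ => r T ^ 2 + ⟪u T, x⟫) := by
    rw [Matrix.fromBlocks_multiply, ← hdC, ← hKC]
    simp [sub_eq_neg_add]
  have hdet := congrArg Matrix.det hmul
  rw [Matrix.det_mul, Matrix.det_fromBlocks_zero₂₁, Matrix.det_fromBlocks_zero₁₂, ← hblock,
    Matrix.det_reindex_self] at hdet
  simpa using hdet

theorem det_kernelMatrix_pos (hV : V₀.IsPositive) (hu : IsUnit V₀) (u : ℕ → H) {r : ℕ → ℝ}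
    (hr : ∀ t, 0 < r t) (T : ℕ) :
    0 < (kernelMatrix V₀ (fun t : Fin T => u t) (fun t => r t)).det := by
  induction T with
  | zero => simp
  | succ T ih =>
    rw [det_kernelMatrix_succ hV hu u hr]
    have h := (isPositive_ringInverse (isPositive_gramOp hV (fun t : Fin T => u t)
      (r := fun t => r t) fun t => hr t) (isUnit_gramOp hV hu _ fun t => hr t)).inner_nonneg_right
      (u T)
    have := hr T
    positivity

/-- The deviation of the estimator is controlled by the score `M* Σ⁻¹ e` of the noise `e`. -/
theorem abs_inner_estimator_sub_le {T : ℕ} (hV : V₀.IsPositive) (hu : IsUnit V₀)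
    (u : Fin T → H) {r : Fin T → ℝ} (hr : ∀ t, 0 < r t) (f w : H)
    (z e : EuclideanSpace ℝ (Fin T)) (hz : z = designOp u f + e) :
    |⟪w, estimator V₀ u r z⟫ - ⟪w, f⟫| ≤
      (weightedNorm (Ring.inverse (gramOp V₀ u r))
        (ContinuousLinearMap.adjoint (designOp u) (Ring.inverse (noiseOp r) e)) +
        weightedNorm V₀ f) * weightedNorm (Ring.inverse (gramOp V₀ u r)) w := by
  have hG := isPositive_gramOp hV u hr
  have hGu := isUnit_gramOp hV hu u hr
  have hGi := isPositive_ringInverse hG hGu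
  set G := gramOp V₀ u r with hGd
  set S := ContinuousLinearMap.adjoint (designOp u) (Ring.inverse (noiseOp r) e) with hS
  -- Uses M* Σ⁻¹ M f = V_T f - V₀ f.
  have hest : estimator V₀ u r z - f = Ring.inverse G (S - V₀ f) := by
    rw [(estimator_spec hV hu u hr z).2, ← ringInverse_apply hGu f, ← hGd, ← map_sub,
      ringInverse_apply hGu]
    congr 1
    rw [hz, map_add, map_add, hGd, gramOp]
    simp only [add_apply, ContinuousLinearMap.comp_apply]
    abel
  -- With x = V_T⁻¹ V₀ f, the squared left side is ⟨x, V₀ f⟩ ≤ ‖x‖_{V₀} ‖f‖_{V₀}, and ‖x‖_{V₀} ≤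
  -- ‖x‖_{V_T}, which is the left side itself; divide by it.
  have hV₀f : weightedNorm (Ring.inverse G) (V₀ f) ≤ weightedNorm V₀ f := by
    set x := Ring.inverse G (V₀ f) with hx
    have h1 : weightedNorm (Ring.inverse G) (V₀ f) ^ 2 = ⟪x, V₀ f⟫ := by
      rw [sq_weightedNorm hGi, real_inner_comm]
    have h2 := (le_abs_self _).trans (abs_inner_le_weightedNorm_mul hV x f)
    have h3 : weightedNorm V₀ x ≤ weightedNorm (Ring.inverse G) (V₀ f) := by
      refine le_of_sq_le_sq ?_ (weightedNorm_nonneg _)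
      rw [h1, sq_weightedNorm hV, ← apply_ringInverse hGu (V₀ f), ← hx, hGd, gramOp]
      simp only [add_apply, ContinuousLinearMap.comp_apply, inner_add_right,
        ContinuousLinearMap.adjoint_inner_right]
      linarith [(isPositive_ringInverse_noiseOp hr).inner_nonneg_right (designOp u x)]
    rcases (weightedNorm_nonneg (A := Ring.inverse G) (V₀ f)).eq_or_lt with h0 | h0
    · rw [← h0]
      exact weightedNorm_nonneg _
    · refine le_of_mul_le_mul_left ?_ h0
      rw [← sq, h1]
      exact h2.trans (mul_le_mul_of_nonneg_right h3 (weightedNorm_nonneg _))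
  rw [← inner_sub_right, hest, mul_comm]
  refine (abs_inner_le_weightedNorm_mul hGi _ _).trans
    (mul_le_mul_of_nonneg_left ?_ (weightedNorm_nonneg _))
  exact (weightedNorm_sub_le hGi _ _).trans (add_le_add le_rfl hV₀f)

end Gram

/-! ### The mixture process and its recursion -/

section Mixture

variable {H : Type*} [NormedAddCommGroup H] [InnerProductSpace ℝ H] [CompleteSpace H]
  {V₀ : H →L[ℝ] H}

/-- The inverse `V_T⁻¹` for the first `T` terms of the sequences `u` and `r`. -/
noncomputable def gramInv (V₀ : H →L[ℝ] H) (u : ℕ → H) (r : ℕ → ℝ) (T : ℕ) : H →L[ℝ] H :=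
  Ring.inverse (gramOp V₀ (fun t : Fin T => u t) fun t => r t)

/-- The score `M* Σ⁻¹ e` for the first `T` terms of the sequences `u`, `r` and `e`. -/
noncomputable def score (u : ℕ → H) (r e : ℕ → ℝ) (T : ℕ) : H :=
  ∑ t ∈ Finset.range T, ((r t ^ 2)⁻¹ * e t) • u t

/-- The ratio `det (Σ + M V₀⁻¹ M*) / det Σ` for the first `T` terms of `u` and `r`. -/
noncomputable def detRatio (V₀ : H →L[ℝ] H) (u : ℕ → H) (r : ℕ → ℝ) (T : ℕ) : ℝ :=
  (kernelOp V₀ (fun t : Fin T => u t) fun t => r t).det / (noiseOp fun t : Fin T => r t).det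

/-- The Gaussian mixture `(det (Σ + M V₀⁻¹ M*) / det Σ)^(-1/2) exp (‖M* Σ⁻¹ e‖²_{V_T⁻¹} / 2)`. -/
noncomputable def mixture (V₀ : H →L[ℝ] H) (u : ℕ → H) (r e : ℕ → ℝ) (T : ℕ) : ℝ :=
  (Real.sqrt (detRatio V₀ u r T))⁻¹ *
    Real.exp (⟪score u r e T, gramInv V₀ u r T (score u r e T)⟫ / 2)

theorem adjoint_designOp_ringInverse_noiseOp (u : ℕ → H) {r : ℕ → ℝ} (hr : ∀ t, 0 < r t)
    (e : ℕ → ℝ) (T : ℕ) :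
    ContinuousLinearMap.adjoint (designOp fun t : Fin T => u t)
      (Ring.inverse (noiseOp fun t : Fin T => r t) (WithLp.toLp 2 fun t : Fin T => e t)) =
      score u r e T := by
  rw [adjoint_designOp_apply, score, Finset.sum_range]
  exact Finset.sum_congr rfl fun t _ => by rw [ringInverse_noiseOp_apply fun t => hr t]

theorem isPositive_gramInv (hV : V₀.IsPositive) (hu : IsUnit V₀) (u : ℕ → H) {r : ℕ → ℝ}
    (hr : ∀ t, 0 < r t) (T : ℕ) : (gramInv V₀ u r T).IsPositive :=
  isPositive_ringInverse (isPositive_gramOp hV _ fun t => hr t)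
    (isUnit_gramOp hV hu _ fun t => hr t)

theorem gramInv_zero (u : ℕ → H) (r : ℕ → ℝ) : gramInv V₀ u r 0 = Ring.inverse V₀ := by
  rw [gramInv, gramOp_zero_apply]

theorem gramInv_succ (hV : V₀.IsPositive) (hu : IsUnit V₀) (u : ℕ → H) {r : ℕ → ℝ}
    (hr : ∀ t, 0 < r t) (T : ℕ) (x : H) :
    gramInv V₀ u r (T + 1) x = gramInv V₀ u r T x -
      ((r T ^ 2)⁻¹ * ⟪u T, gramInv V₀ u r T x⟫ /
        (1 + (r T ^ 2)⁻¹ * ⟪u T, gramInv V₀ u r T (u T)⟫)) • gramInv V₀ u r T (u T) :=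
  ringInverse_rankOne_update (isPositive_gramOp hV _ fun t => hr t)
    (isUnit_gramOp hV hu _ fun t => hr t) (isUnit_gramOp hV hu _ fun t => hr t)
    (by positivity) (gramOp_succ_apply u hr T) x

theorem detRatio_pos (hV : V₀.IsPositive) (hu : IsUnit V₀) (u : ℕ → H) {r : ℕ → ℝ}
    (hr : ∀ t, 0 < r t) (T : ℕ) : 0 < detRatio V₀ u r T := by
  rw [detRatio, det_kernelOp, det_noiseOp]
  exact div_pos (det_kernelMatrix_pos hV hu u hr T) (Finset.prod_pos fun t _ => pow_pos (hr t) 2)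

theorem detRatio_succ (hV : V₀.IsPositive) (hu : IsUnit V₀) (u : ℕ → H) {r : ℕ → ℝ}
    (hr : ∀ t, 0 < r t) (T : ℕ) :
    detRatio V₀ u r (T + 1) = detRatio V₀ u r T *
      (1 + (r T ^ 2)⁻¹ * ⟪u T, gramInv V₀ u r T (u T)⟫) := by
  have h1 : ∏ t : Fin T, r t ^ 2 ≠ 0 :=
    (Finset.prod_pos fun (t : Fin T) _ => pow_pos (hr t) 2).ne'
  have h2 := (hr T).ne'
  simp only [detRatio, det_kernelOp, det_noiseOp, det_kernelMatrix_succ hV hu u hr, gramInv,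
    Fin.prod_univ_castSucc, Fin.val_castSucc, Fin.val_last]
  field_simp

theorem mixture_zero (u : ℕ → H) (r e : ℕ → ℝ) : mixture V₀ u r e 0 = 1 := by
  simp [mixture, detRatio, det_kernelOp, det_noiseOp, score]

/-- The determinant recursion supplies the prefactor and Sherman–Morrison the exponent, in the shape
of the Gaussian average in `lintegral_mul_mixture_le`; the standard deviation `s` is the weighted
norm of `u T`. -/
theorem mixture_succ (hV : V₀.IsPositive) (hu : IsUnit V₀) (u : ℕ → H) {r : ℕ → ℝ}
    (hr : ∀ t, 0 < r t) (e : ℕ → ℝ) (T : ℕ) :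
    mixture V₀ u r e (T + 1) = mixture V₀ u r e T *
      ((Real.sqrt (1 + (r T ^ 2)⁻¹ * weightedNorm (gramInv V₀ u r T) (u T) ^ 2))⁻¹ * Real.exp
        ((2 * (r T ^ 2)⁻¹ * e T * ⟪u T, gramInv V₀ u r T (score u r e T)⟫ +
          ((r T ^ 2)⁻¹) ^ 2 * e T ^ 2 * weightedNorm (gramInv V₀ u r T) (u T) ^ 2
          - (r T ^ 2)⁻¹ * ⟪u T, gramInv V₀ u r T (score u r e T)⟫ ^ 2) /
          (1 + (r T ^ 2)⁻¹ * weightedNorm (gramInv V₀ u r T) (u T) ^ 2) / 2)) := by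
  have hq := inner_ringInverse_rankOne_update (isPositive_gramOp hV _ fun t => hr t)
    (isUnit_gramOp hV hu _ fun t => hr t) (isUnit_gramOp hV hu _ fun t => hr t)
    (by positivity) (gramOp_succ_apply u hr T) (score u r e T) (e T)
  rw [mixture, mixture, detRatio_succ hV hu u hr, Real.sqrt_mul (detRatio_pos hV hu u hr T).le,
    sq_weightedNorm (isPositive_gramInv hV hu u hr T), score, Finset.sum_range_succ, ← score]
  simp only [gramInv] at hq ⊢
  rw [hq, add_div, Real.exp_add, mul_inv]
  ring

theorem mixture_nonneg (u : ℕ → H) (r e : ℕ → ℝ) (T : ℕ) : 0 ≤ mixture V₀ u r e T := by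
  unfold mixture
  positivity

theorem weightedNorm_score_le_of_mixture_le (hV : V₀.IsPositive) (hu : IsUnit V₀) (u : ℕ → H)
    {r : ℕ → ℝ} (hr : ∀ t, 0 < r t) (e : ℕ → ℝ) (T : ℕ) {c : ℝ}
    (h : mixture V₀ u r e T ≤ c) :
    weightedNorm (gramInv V₀ u r T) (score u r e T) ≤
      Real.sqrt (2 * Real.log (c * ((kernelOp V₀ (fun t : Fin T => u t) fun t => r t).det ^
        (1 / 2 : ℝ) * (noiseOp fun t : Fin T => r t).det ^ (-(1 / 2) : ℝ)))) := by
  have hD := Real.sqrt_pos.2 (detRatio_pos hV hu u hr T)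
  have hdet : (kernelOp V₀ (fun t : Fin T => u t) fun t => r t).det ^ (1 / 2 : ℝ) *
      (noiseOp fun t : Fin T => r t).det ^ (-(1 / 2) : ℝ) = Real.sqrt (detRatio V₀ u r T) := by
    have h0 : 0 ≤ (noiseOp fun t : Fin T => r t).det := by
      rw [det_noiseOp]
      positivity
    rw [Real.rpow_neg h0, ← Real.sqrt_eq_rpow, ← Real.sqrt_eq_rpow, detRatio,
      Real.sqrt_div' _ h0, div_eq_mul_inv]
  rw [hdet]
  refine Real.sqrt_le_sqrt ?_
  have h1 : Real.exp (⟪score u r e T, gramInv V₀ u r T (score u r e T)⟫ / 2) ≤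
      c * Real.sqrt (detRatio V₀ u r T) := by
    rw [mixture, inv_mul_le_iff₀ hD] at h
    linarith
  have h2 := (Real.le_log_iff_exp_le ((Real.exp_pos _).trans_le h1)).2 h1
  linarith

end Mixture

/-! ### Measurability of the score -/

section Score

variable {Ω : Type*} {m : MeasurableSpace Ω} {H : Type*} [NormedAddCommGroup H]
  [InnerProductSpace ℝ H] {𝓕 : Filtration ℕ m} {v : ℕ → Ω → H} {ρ ε : ℕ → Ω → ℝ}

theorem stronglyMeasurable_score (hv : StronglyAdapted 𝓕 v) (hρ : StronglyAdapted 𝓕 ρ)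
    (hε : ∀ t, StronglyMeasurable[𝓕 (t + 1)] (ε t)) (T : ℕ) :
    StronglyMeasurable[𝓕 T] fun ω =>
      score (fun t => v t ω) (fun t => ρ t ω) (fun t => ε t ω) T := by
  unfold score
  refine Finset.stronglyMeasurable_fun_sum _ fun t ht => ?_
  have ht' : t < T := Finset.mem_range.1 ht
  have h1 : StronglyMeasurable[𝓕 T] (ρ t) := (hρ t).mono (𝓕.mono ht'.le)
  -- The score at `T` uses noise up to index `T - 1` only, and t + 1 ≤ T.
  have h2 : StronglyMeasurable[𝓕 T] (ε t) := (hε t).mono (𝓕.mono ht')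
  have h3 : StronglyMeasurable[𝓕 T] fun ω => (ρ t ω ^ 2)⁻¹ :=
    (h1.measurable.pow_const 2).inv.stronglyMeasurable
  exact (h3.mul h2).smul ((hv t).mono (𝓕.mono ht'.le))

end Score

/-! ### Adaptedness and the supermartingale property -/

section Supermartingale

variable {Ω : Type*} {m : MeasurableSpace Ω} {μ : Measure Ω}
  {H : Type*} [NormedAddCommGroup H] [InnerProductSpace ℝ H] [CompleteSpace H]
  {V₀ : H →L[ℝ] H} {𝓕 : Filtration ℕ m} {v : ℕ → Ω → H} {ρ ε : ℕ → Ω → ℝ}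

/-- Induction with Sherman–Morrison reduces everything to inner products of measurable vectors, so
no measurable structure on operators is needed; `x` varies because the recursion also needs V_T⁻¹
v_T. The range T ≤ n + 1 reflects that V_T involves actions up to index T - 1 only. -/
theorem stronglyMeasurable_gramInv (hV : V₀.IsPositive) (hu : IsUnit V₀)
    (hv : StronglyAdapted 𝓕 v) (hρ : StronglyAdapted 𝓕 ρ) (hρpos : ∀ t ω, 0 < ρ t ω)
    {n T : ℕ} (hT : T ≤ n + 1) {x : Ω → H} (hx : StronglyMeasurable[𝓕 n] x) :
    StronglyMeasurable[𝓕 n] fun ω => gramInv V₀ (fun t => v t ω) (fun t => ρ t ω) T (x ω) := by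
  induction T generalizing x with
  | zero =>
    simp only [gramInv_zero]
    exact (Ring.inverse V₀).continuous.comp_stronglyMeasurable hx
  | succ T ih =>
    have hTn : T ≤ n := by omega
    have hvT : StronglyMeasurable[𝓕 n] (v T) := (hv T).mono (𝓕.mono hTn)
    have hρT : StronglyMeasurable[𝓕 n] (ρ T) := (hρ T).mono (𝓕.mono hTn)
    have h1 := ih (by omega) hx
    have h2 := ih (by omega) hvT
    have h3 : StronglyMeasurable[𝓕 n] fun ω => (ρ T ω ^ 2)⁻¹ :=
      (hρT.measurable.pow_const 2).inv.stronglyMeasurable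
    have h4 : StronglyMeasurable[𝓕 n] fun ω => (ρ T ω ^ 2)⁻¹ *
        ⟪v T ω, gramInv V₀ (fun t => v t ω) (fun t => ρ t ω) T (x ω)⟫ /
        (1 + (ρ T ω ^ 2)⁻¹ *
          ⟪v T ω, gramInv V₀ (fun t => v t ω) (fun t => ρ t ω) T (v T ω)⟫) :=
      ((h3.mul (hvT.inner h1)).measurable.div
        (stronglyMeasurable_const.add (h3.mul (hvT.inner h2))).measurable).stronglyMeasurable
    simp only [gramInv_succ hV hu _ (fun t => hρpos t _)]
    exact h1.sub (h4.smul h2)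

theorem measurable_inner_gramInv_score (hV : V₀.IsPositive) (hu : IsUnit V₀)
    (hv : StronglyAdapted 𝓕 v) (hρ : StronglyAdapted 𝓕 ρ) (hρpos : ∀ t ω, 0 < ρ t ω)
    (hε : ∀ t, StronglyMeasurable[𝓕 (t + 1)] (ε t)) (T : ℕ) :
    Measurable[𝓕 T] fun ω => ⟪v T ω, gramInv V₀ (fun t => v t ω) (fun t => ρ t ω) T
      (score (fun t => v t ω) (fun t => ρ t ω) (fun t => ε t ω) T)⟫ :=
  ((hv T).inner (stronglyMeasurable_gramInv hV hu hv hρ hρpos T.le_succ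
    (stronglyMeasurable_score hv hρ hε T))).measurable

theorem measurable_weightedNorm_gramInv (hV : V₀.IsPositive) (hu : IsUnit V₀)
    (hv : StronglyAdapted 𝓕 v) (hρ : StronglyAdapted 𝓕 ρ) (hρpos : ∀ t ω, 0 < ρ t ω) (T : ℕ) :
    Measurable[𝓕 T] fun ω =>
      weightedNorm (gramInv V₀ (fun t => v t ω) (fun t => ρ t ω) T) (v T ω) :=
  ((hv T).inner
    (stronglyMeasurable_gramInv hV hu hv hρ hρpos T.le_succ (hv T))).measurable.sqrt

theorem measurable_mixture (hV : V₀.IsPositive) (hu : IsUnit V₀)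
    (hv : StronglyAdapted 𝓕 v) (hρ : StronglyAdapted 𝓕 ρ) (hρpos : ∀ t ω, 0 < ρ t ω)
    (hε : ∀ t, StronglyMeasurable[𝓕 (t + 1)] (ε t)) (T : ℕ) :
    Measurable[𝓕 T] fun ω =>
      mixture V₀ (fun t => v t ω) (fun t => ρ t ω) (fun t => ε t ω) T := by
  induction T with
  | zero => simp only [mixture_zero]; exact measurable_const
  | succ T ih =>
    have hmono := 𝓕.mono T.le_succ
    have h1 := ih.mono hmono le_rfl
    have h2 := (measurable_inner_gramInv_score hV hu hv hρ hρpos hε T).mono hmono le_rfl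
    have h3 := (measurable_weightedNorm_gramInv hV hu hv hρ hρpos T).mono hmono le_rfl
    have h4 := (hρ T).measurable.mono hmono le_rfl
    have h5 := (hε T).measurable
    simp only [mixture_succ hV hu _ (fun t => hρpos t _)]
    fun_prop

/-- The current mixture restricted to `A` is an 𝓕_T-measurable weight, so the one-step mixing
inequality applies to it with the factor from `mixture_succ`. -/
theorem setLIntegral_mixture_succ_le [IsFiniteMeasure μ] (hV : V₀.IsPositive) (hu : IsUnit V₀)
    (hv : StronglyAdapted 𝓕 v) (hρ : StronglyAdapted 𝓕 ρ) (hρpos : ∀ t ω, 0 < ρ t ω)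
    (hε : ∀ t, StronglyMeasurable[𝓕 (t + 1)] (ε t))
    (hsub : ∀ (t : ℕ) (l : ℝ),
      μ⁻[fun ω => ENNReal.ofReal (Real.exp (l * ε t ω)) | 𝓕 t] ≤ᵐ[μ]
        fun ω => ENNReal.ofReal (Real.exp (l ^ 2 * ρ t ω ^ 2 / 2)))
    (T : ℕ) {A : Set Ω} (hA : MeasurableSet[𝓕 T] A) :
    ∫⁻ ω in A, ENNReal.ofReal
        (mixture V₀ (fun t => v t ω) (fun t => ρ t ω) (fun t => ε t ω) (T + 1)) ∂μ ≤
      ∫⁻ ω in A, ENNReal.ofReal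
        (mixture V₀ (fun t => v t ω) (fun t => ρ t ω) (fun t => ε t ω) T) ∂μ := by
  have hA' := 𝓕.le T A hA
  have hf : Measurable[𝓕 T] (A.indicator fun ω => ENNReal.ofReal
      (mixture V₀ (fun t => v t ω) (fun t => ρ t ω) (fun t => ε t ω) T)) :=
    (measurable_mixture hV hu hv hρ hρpos hε T).ennreal_ofReal.indicator hA
  have key := lintegral_mul_mixture_le (μ := μ) (𝓕.le T) (hρ T).measurable (hρpos T)
    ((hε T).measurable.mono (𝓕.le _) le_rfl)
    (measurable_inner_gramInv_score hV hu hv hρ hρpos hε T)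
    (measurable_weightedNorm_gramInv hV hu hv hρ hρpos T) (hsub T) hf
  rw [← lintegral_indicator hA', ← lintegral_indicator hA']
  refine le_trans (le_of_eq (lintegral_congr fun ω => ?_)) key
  by_cases hω : ω ∈ A
  · rw [Set.indicator_of_mem hω, Set.indicator_of_mem hω,
      mixture_succ hV hu _ (fun t => hρpos t _), ENNReal.ofReal_mul (mixture_nonneg _ _ _ _)]
  · rw [Set.indicator_of_notMem hω, Set.indicator_of_notMem hω, zero_mul]

end Supermartingale

end HetLS

/-! ### The confidence bound -/

theorem mainTheorem7 {Ω : Type*} {m : MeasurableSpace Ω} (μ : Measure Ω) [IsProbabilityMeasure μ]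
    {H : Type*} [NormedAddCommGroup H] [InnerProductSpace ℝ H] [CompleteSpace H]
    [TopologicalSpace.SeparableSpace H]
    (V₀ : H →L[ℝ] H) (hV₀ : V₀.IsPositive) (hV₀inv : IsUnit V₀) (fstar : H)
    -- time starts at 0: index `t` is the `(t + 1)`-st round; `𝓕 t` is the information available
    -- just before the noise `ε t` is realized (all earlier rounds and the current action)
    (𝓕 : Filtration ℕ m) (v : ℕ → Ω → H) (ρ ε y : ℕ → Ω → ℝ)
    (hv : StronglyAdapted 𝓕 v) (hρ : StronglyAdapted 𝓕 ρ) (hρpos : ∀ t ω, 0 < ρ t ω)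
    (hε : ∀ t, StronglyMeasurable[𝓕 (t + 1)] (ε t))
    (hy : ∀ t ω, y t ω = ⟪v t ω, fstar⟫ + ε t ω)
    (hsub : ∀ (t : ℕ) (l : ℝ),
      μ⁻[fun ω => ENNReal.ofReal (Real.exp (l * ε t ω)) | 𝓕 t] ≤ᵐ[μ]
        fun ω => ENNReal.ofReal (Real.exp (l ^ 2 * ρ t ω ^ 2 / 2)))
    (δ : ℝ) (hδ : 0 < δ) (hδ1 : δ < 1) :
    ENNReal.ofReal (1 - δ) ≤ μ {ω | ∀ T : ℕ, 1 ≤ T → ∀ w : H,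
      let u : Fin T → H := fun t => v t ω
      let r : Fin T → ℝ := fun t => ρ t ω
      let z : EuclideanSpace ℝ (Fin T) := WithLp.toLp 2 fun t => y t ω
      |⟪w, HetLS.estimator V₀ u r z⟫ - ⟪w, fstar⟫| ≤
        (Real.sqrt (2 * Real.log (1 / δ *
            ((HetLS.kernelOp V₀ u r).det ^ (1 / 2 : ℝ) *
              (HetLS.noiseOp r).det ^ (-(1 / 2) : ℝ)))) +
          HetLS.weightedNorm V₀ fstar) *
          HetLS.weightedNorm (Ring.inverse (HetLS.gramOp V₀ u r)) w} := by
  set Z : ℕ → Ω → ENNReal := fun T ω => ENNReal.ofReal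
    (HetLS.mixture V₀ (fun t => v t ω) (fun t => ρ t ω) (fun t => ε t ω) T) with hZ
  have hville := HetLS.mul_measure_exists_le_le (μ := μ) (𝓕 := 𝓕) (Z := Z)
    (fun n => (HetLS.measurable_mixture hV₀ hV₀inv hv hρ hρpos hε n).ennreal_ofReal)
    (fun n A hA => HetLS.setLIntegral_mixture_succ_le hV₀ hV₀inv hv hρ hρpos hε hsub n hA)
    (ENNReal.ofReal (1 / δ))
  -- A single exceptional event, independent of `w` and covering every horizon, gives the
  -- uniformity.
  set bad := {ω | ∃ n, ENNReal.ofReal (1 / δ) ≤ Z n ω} with hbad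
  have hbad_le : μ bad ≤ ENNReal.ofReal δ := by
    have h1 : ∫⁻ ω, Z 0 ω ∂μ = 1 := by simp [hZ, HetLS.mixture_zero]
    rw [h1] at hville
    calc μ bad = ENNReal.ofReal δ * (ENNReal.ofReal (1 / δ) * μ bad) := by
          rw [← mul_assoc, ← ENNReal.ofReal_mul hδ.le, mul_one_div_cancel hδ.ne']
          simp
      _ ≤ ENNReal.ofReal δ * 1 := by gcongr
      _ = _ := mul_one _
  have hgood : ENNReal.ofReal (1 - δ) ≤ μ badᶜ := by
    rw [ENNReal.ofReal_sub _ hδ.le, ENNReal.ofReal_one, tsub_le_iff_right]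
    calc (1 : ENNReal) = μ (badᶜ ∪ bad) := by rw [Set.compl_union_self, measure_univ]
      _ ≤ μ badᶜ + μ bad := measure_union_le _ _
      _ ≤ _ := by gcongr
  -- Only the inclusion of the good event is needed, so measurability of the target event, a
  -- condition over all `w`, never arises.
  refine hgood.trans (measure_mono fun ω hω T _ w => ?_)
  have hr : ∀ t, 0 < ρ t ω := fun t => hρpos t ω
  have hle : HetLS.mixture V₀ (fun t => v t ω) (fun t => ρ t ω) (fun t => ε t ω) T ≤ 1 / δ := by
    by_contra hlt
    exact hω ⟨T, ENNReal.ofReal_le_ofReal (not_le.1 hlt).le⟩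
  have hz : (WithLp.toLp 2 fun t : Fin T => y t ω) =
      HetLS.designOp (fun t : Fin T => v t ω) fstar + WithLp.toLp 2 fun t : Fin T => ε t ω := by
    ext t
    simp [HetLS.designOp_apply, hy]
  refine (HetLS.abs_inner_estimator_sub_le hV₀ hV₀inv (fun t : Fin T => v t ω)
    (r := fun t => ρ t ω) (fun t => hr t) fstar w _ _ hz).trans
    (mul_le_mul_of_nonneg_right (add_le_add ?_ le_rfl) (HetLS.weightedNorm_nonneg w))
  rw [HetLS.adjoint_designOp_ringInverse_noiseOp (fun t => v t ω) hr (fun t => ε t ω) T]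
  exact HetLS.weightedNorm_score_le_of_mixture_le hV₀ hV₀inv (fun t => v t ω) hr
    (fun t => ε t ω) T hle
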